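/- For integers $m\ge 1$ and even $p\ge 2$ let $N_{\mathbb C}(m,p)$ be the minimal $n$ such that there is a $\mathbb C$-linear isometric embedding $\ell_{2;\mathbb C}^m\to\ell_{p;\mathbb C}^n$, i.e. a $\mathbb C$-linear map $f:\mathbb C^m\to\mathbb C^n$ with $\|f(y)\|_p=\|y\|_2$ for all $y$, where $\|x\|_p=\big(\sum_k|x_k|^p\big)^{1/p}$. Let $s\ge 2$ be an integer. Then such embeddings with $p=2s$ exist for every $m\ge1$ (and some $n$), and for all integers $m\ge 2$ $$N_{\mathbb C}(m,2s)\le\begin{cases}\dfrac{(s+1)^2}{2}\,N_{\mathbb C}(m-1,2s), & s \text{ odd},\\[2mm] \dfrac{s+2}{2}\,\big(s\,N_{\mathbb C}(m-1,2s)+1\big), & s\text{ even}.\end{cases}$$ In particular, $$N_{\mathbb C}(2,2s)\le\begin{cases}\dfrac{(s+1)^2}{2}, & s \text{ odd},\\[2mm] \dfrac{(s+2)(s+1)}{2}, & s\text{ even},\end{cases}\qquad N_{\mathbb C}(3,2s)\le\begin{cases}\dfrac{(s+1)^4}{4}, & s \text{ odd},\\[2mm] \dfrac{s+2}{2}\Big(\dfrac{(s+2)(s+1)s}{2}+1\Big),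 & s\text{ even}.\end{cases}$$ -/

import Mathlib

open scoped ENNReal

/-- There is a `ℂ`-linear isometric embedding of the complex Euclidean space `ℓ₂^m` into the complex
space `ℓ_p^n`, i.e. into `ℂⁿ` with the norm `‖x‖_p = (∑ |x_k| ^ p) ^ (1 / p)` (for `1 ≤ p`). -/
def HasComplexEmbedding (m p n : ℕ) : Prop :=
  ∃ f : EuclideanSpace ℂ (Fin m) →ₗ[ℂ] PiLp (p : ℝ≥0∞) (fun _ : Fin n => ℂ),
    ∀ y, ‖f y‖ = ‖y‖

/-- `N_ℂ(m, p)`: the minimal `n` such that `ℓ₂^m` embeds `ℂ`-linearly and isometrically into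
`ℓ_p^n`. -/
noncomputable def NC (m p : ℕ) : ℕ :=
  sInf {n : ℕ | HasComplexEmbedding m p n}

/-! An embedding is a system of vectors `v k` with `∑ ‖⟪v k, y⟫‖ ^ (2 * s) = ‖y‖ ^ (2 * s)`. Such a
system also fixes every lower moment `∑ ‖v k‖ ^ (2 * (s - i)) * ‖⟪v k, y⟫‖ ^ (2 * i)` as an explicit
multiple of `‖y‖ ^ (2 * i)` (`sum_norm_pow_mul_norm_inner_pow`).

To add a coordinate `η` to `z`, take the functionals `ζ ^ l * √(1 - t) * ⟪v k, z⟫ + √t * ‖v k‖ * η`,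
with `ζ` a primitive `(s + 1)`-th root of unity. Summing over `l` kills the cross terms, summing
over `k` inserts the moments, and a quadrature in `t` for the weight `(1 - t) ^ a` turns `(1 - t) ^
i * t ^ (s - i)` into Beta values. The factorials then collapse to binomial coefficients, giving
`(‖z‖ ^ 2 + ‖η‖ ^ 2) ^ s` (`HasComplexEmbedding.succ_of_quadrature`).

Only exactness up to degree `s` is needed: Gauss with `(s + 1) / 2` nodes for odd `s`, Radau with `s
/ 2` interior nodes and the node `1` for even `s`. At `t = 1` all functionals are multiples of `η`
and merge into one. -/

/-! ### Gauss and Radau quadrature for positive functionals -/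

section Quadrature

open Polynomial

/-- A linear functional on real polynomials that is strictly positive on the nonzero polynomials
that are nonnegative on `[0, 1]`. -/
def IsPosFunctional (L : ℝ[X] →ₗ[ℝ] ℝ) : Prop :=
  ∀ p : ℝ[X], (∀ t ∈ Set.Icc (0 : ℝ) 1, 0 ≤ p.eval t) → p ≠ 0 → 0 < L p

theorem IsPosFunctional.exists_orthogonal {L : ℝ[X] →ₗ[ℝ] ℝ} (hL : IsPosFunctional L) (n : ℕ) :
    ∃ P : ℝ[X], P.natDegree = n ∧ P ≠ 0 ∧ ∀ q : ℝ[X], q.degree < n → L (P * q) = 0 := by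
  let B : degreeLT ℝ n →ₗ[ℝ] Module.Dual ℝ (degreeLT ℝ n) :=
    LinearMap.mk₂ ℝ (fun p q => L (p.1 * q.1))
      (fun p p' q => by simp [add_mul]) (fun c p q => by simp)
      (fun p q q' => by simp [mul_add]) (fun c p q => by simp)
  have hB : ∀ p q, B p q = L (p.1 * q.1) := fun _ _ => rfl
  have : FiniteDimensional ℝ (degreeLT ℝ n) :=
    Module.Finite.equiv (degreeLTEquiv ℝ n).symm
  -- Positivity on squares makes the form definite, so `q ↦ L (X ^ n * q)` is represented by some
  -- `r` of degree below `n`, and `X ^ n - r` is orthogonal.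
  have hinj : Function.Injective B := by
    rw [injective_iff_map_eq_zero]
    intro p hp
    by_contra h
    have h1 : B p p = 0 := by rw [hp]; rfl
    rw [hB] at h1
    have h2 : p.1 ≠ 0 := fun h' => h (Subtype.ext h')
    have := hL (p.1 * p.1) (fun t _ => by rw [eval_mul]; exact mul_self_nonneg _)
      (mul_ne_zero h2 h2)
    exact this.ne' h1
  have hsurj : Function.Surjective B :=
    (LinearMap.injective_iff_surjective_of_finrank_eq_finrank
      (Subspace.dual_finrank_eq).symm).1 hinj
  let φ : Module.Dual ℝ (degreeLT ℝ n) :=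
    (L ∘ₗ LinearMap.mulLeft ℝ (X ^ n : ℝ[X])) ∘ₗ (degreeLT ℝ n).subtype
  obtain ⟨r, hr⟩ := hsurj φ
  have hrd : (-r.1).degree < n := by rw [degree_neg]; exact mem_degreeLT.1 r.2
  refine ⟨X ^ n + -r.1, ?_, (monic_X_pow_add hrd).ne_zero, fun q hq => ?_⟩
  · refine natDegree_eq_of_degree_eq_some ?_
    rw [degree_add_eq_left_of_degree_lt (by rwa [degree_X_pow]), degree_X_pow]
  · have h := LinearMap.congr_fun hr ⟨q, mem_degreeLT.2 hq⟩
    rw [hB] at h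
    have h' : L (r.1 * q) = L (X ^ n * q) := h
    rw [add_mul, neg_mul, map_add, map_neg, h', add_neg_cancel]

/-- A nonzero real polynomial, multiplied by the nodal polynomial of a suitable set of its roots in
`(0, 1)`, has constant sign on `[0, 1]`. -/
theorem exists_nodal_mul_constant_sign (p : ℝ[X]) (hp : p ≠ 0) :
    ∃ S : Finset ℝ, (∀ t ∈ S, t ∈ Set.Ioo (0 : ℝ) 1) ∧ (∏ t ∈ S, (X - C t)) ∣ p ∧
      ((∀ x ∈ Set.Icc (0 : ℝ) 1, 0 ≤ (p * ∏ t ∈ S, (X - C t)).eval x) ∨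
        (∀ x ∈ Set.Icc (0 : ℝ) 1, (p * ∏ t ∈ S, (X - C t)).eval x ≤ 0)) := by
  induction hd : p.natDegree generalizing p with
  | zero =>
    obtain ⟨c, rfl⟩ := natDegree_eq_zero.1 hd
    refine ⟨∅, by simp, by simp, ?_⟩
    rcases le_total 0 c with h | h
    · left; intro x _; simpa using h
    · right; intro x _; simpa using h
  | succ d ih =>
    by_cases hroot : ∃ t ∈ Set.Ioo (0 : ℝ) 1, p.eval t = 0
    · obtain ⟨t, ht, h0⟩ := hroot
      obtain ⟨r, rfl⟩ := dvd_iff_isRoot.2 h0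
      have hr : r ≠ 0 := right_ne_zero_of_mul hp
      have hrd : r.natDegree = d := by
        rw [natDegree_mul (X_sub_C_ne_zero t) hr, natDegree_X_sub_C] at hd
        omega
      obtain ⟨S, hS, hdvd, hsign⟩ := ih r hr hrd
      -- `S` collects the roots of odd multiplicity, so one more factor `X - t` toggles the
      -- membership of `t`.
      by_cases htS : t ∈ S
      · refine ⟨S.erase t, fun x hx => hS x (Finset.mem_of_mem_erase hx), ?_, ?_⟩
        · exact ((Finset.prod_dvd_prod_of_subset _ _ _ (Finset.erase_subset t S)).trans hdvd).trans
            (dvd_mul_left _ _)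
        · have : (X - C t) * r * ∏ x ∈ S.erase t, (X - C x) = r * ∏ x ∈ S, (X - C x) := by
            rw [← Finset.mul_prod_erase S _ htS]; ring
          rw [this]; exact hsign
      · refine ⟨insert t S, ?_, ?_, ?_⟩
        · intro x hx
          rcases Finset.mem_insert.1 hx with rfl | hx
          exacts [ht, hS x hx]
        · rw [Finset.prod_insert htS]
          exact mul_dvd_mul_left _ hdvd
        · have : (X - C t) * r * ∏ x ∈ insert t S, (X - C x) =
              (X - C t) ^ 2 * (r * ∏ x ∈ S, (X - C x)) := by
            rw [Finset.prod_insert htS]; ring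
          rw [this]
          refine hsign.imp (fun h x hx => ?_) (fun h x hx => ?_)
          · rw [eval_mul]
            exact mul_nonneg (by simpa using sq_nonneg _) (h x hx)
          · rw [eval_mul]
            exact mul_nonpos_of_nonneg_of_nonpos (by simpa using sq_nonneg _) (h x hx)
    · refine ⟨∅, by simp, by simp, ?_⟩
      push Not at hroot
      simp only [Finset.prod_empty, mul_one]
      have hcl : closure (Set.Ioo (0 : ℝ) 1) = Set.Icc 0 1 := closure_Ioo (by norm_num)
      have key : (∀ x ∈ Set.Ioo (0 : ℝ) 1, 0 < p.eval x) ∨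
          (∀ x ∈ Set.Ioo (0 : ℝ) 1, p.eval x < 0) := by
        by_contra hcon
        push Not at hcon
        obtain ⟨⟨a, ha, hpa⟩, b, hb, hpb⟩ := hcon
        obtain ⟨c, hc, hc0⟩ := (isPreconnected_Ioo (a := (0 : ℝ)) (b := 1)).intermediate_value
          ha hb p.continuous.continuousOn ⟨hpa, hpb⟩
        exact hroot c hc hc0
      refine key.imp (fun h x hx => ?_) (fun h x hx => ?_)
      · rw [← hcl] at hx
        exact closure_minimal (fun y hy => (h y hy).le)
          (isClosed_le continuous_const p.continuous) hx
      · rw [← hcl] at hx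
        exact closure_minimal (fun y hy => (h y hy).le)
          (isClosed_le p.continuous continuous_const) hx

/-- The nodes of the Gauss quadrature formula of a positive functional. -/
theorem IsPosFunctional.exists_nodes {L : ℝ[X] →ₗ[ℝ] ℝ} (hL : IsPosFunctional L) (n : ℕ) :
    ∃ S : Finset ℝ, S.card = n ∧ (∀ t ∈ S, t ∈ Set.Ioo (0 : ℝ) 1) ∧
      ∀ q : ℝ[X], q.degree < n → L (Lagrange.nodal S id * q) = 0 := by
  obtain ⟨P, hPd, hP0, hPL⟩ := hL.exists_orthogonal n
  obtain ⟨S, hS, ⟨r, hr⟩, hsign⟩ := exists_nodal_mul_constant_sign P hP0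
  have hnod : (∏ t ∈ S, (X - C t)) = Lagrange.nodal S id := rfl
  rw [hnod] at hr hsign
  have hN0 : Lagrange.nodal S (id : ℝ → ℝ) ≠ 0 := Lagrange.nodal_ne_zero
  have hr0 : r ≠ 0 := by rintro rfl; exact hP0 (by rw [hr, mul_zero])
  have hdeg : S.card + r.natDegree = n := by
    rw [← hPd, hr, natDegree_mul hN0 hr0, Lagrange.natDegree_nodal]
  -- With fewer than `n` sign changes, `P` would be orthogonal to the nodal polynomial, although
  -- their product has constant sign.
  have hge : n ≤ S.card := by
    by_contra hlt
    push Not at hlt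
    have h0 := hPL (Lagrange.nodal S id) (by rw [Lagrange.degree_nodal]; exact_mod_cast hlt)
    rcases hsign with h | h
    · exact (hL _ h (mul_ne_zero hP0 hN0)).ne' h0
    · have := hL (-(P * Lagrange.nodal S id)) (fun t ht => by
        rw [eval_neg]; exact neg_nonneg.2 (h t ht)) (neg_ne_zero.2 (mul_ne_zero hP0 hN0))
      rw [map_neg, h0, neg_zero] at this
      exact lt_irrefl _ this
  have hcard : S.card = n := by omega
  refine ⟨S, hcard, hS, fun q hq => ?_⟩
  obtain ⟨c, rfl⟩ := natDegree_eq_zero.1 (show r.natDegree = 0 by omega)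
  have hc : c ≠ 0 := by rintro rfl; exact hr0 C_0
  have h := hPL q hq
  have : Lagrange.nodal S id * C c * q = c • (Lagrange.nodal S id * q) := by
    rw [smul_eq_C_mul]; ring
  rw [hr, this, map_smul, smul_eq_mul] at h
  exact (mul_eq_zero.1 h).resolve_left hc

/-- Gauss quadrature: a positive functional is given on the polynomials of degree less than `2 * n`
by `n` nodes in `(0, 1)` with nonnegative weights. -/
theorem IsPosFunctional.exists_gauss {L : ℝ[X] →ₗ[ℝ] ℝ} (hL : IsPosFunctional L) (n : ℕ) :
    ∃ (S : Finset ℝ) (A : ℝ → ℝ), S.card = n ∧ (∀ t ∈ S, t ∈ Set.Ioo (0 : ℝ) 1) ∧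
      (∀ t ∈ S, 0 ≤ A t) ∧
      ∀ p : ℝ[X], p.degree < ((2 * n : ℕ) : WithBot ℕ) → L p = ∑ t ∈ S, A t * p.eval t := by
  obtain ⟨S, hcard, hS, hort⟩ := hL.exists_nodes n
  have hinj : Set.InjOn (id : ℝ → ℝ) S := Function.injective_id.injOn
  have hexact : ∀ p : ℝ[X], p.degree < ((2 * n : ℕ) : WithBot ℕ) →
      L p = ∑ t ∈ S, L (Lagrange.basis S id t) * p.eval t := by
    intro p hp
    have hmon : (Lagrange.nodal S (id : ℝ → ℝ)).Monic := Lagrange.nodal_monic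
    set N := Lagrange.nodal S (id : ℝ → ℝ) with hN
    have hsplit := modByMonic_add_div p N
    have hrem : (p %ₘ N).degree < S.card := by
      have := degree_modByMonic_lt p hmon
      rwa [hN, Lagrange.degree_nodal] at this
    have hquo : (p /ₘ N).degree < n := by
      by_cases hz : p /ₘ N = 0
      · rw [hz, degree_zero]; exact WithBot.bot_lt_coe _
      · have hp0 : p ≠ 0 := by rintro rfl; simp at hz
        have h1 := natDegree_divByMonic p hmon
        rw [hN, Lagrange.natDegree_nodal, ← hN, hcard] at h1
        rw [degree_eq_natDegree hp0] at hp
        have hp' : p.natDegree < 2 * n := by exact_mod_cast hp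
        have hdle : N.degree ≤ p.degree := by
          by_contra hlt
          push Not at hlt
          exact hz ((divByMonic_eq_zero_iff hmon).2 hlt)
        rw [degree_eq_natDegree hz]
        have h3 : N.natDegree ≤ p.natDegree := natDegree_le_natDegree hdle
        rw [hN, Lagrange.natDegree_nodal, hcard] at h3
        exact_mod_cast (show (p /ₘ N).natDegree < n by omega)
    have hLp : L p = L (p %ₘ N) := by
      conv_lhs => rw [← hsplit]
      rw [map_add, hort _ hquo, add_zero]
    have heval : ∀ t ∈ S, (p %ₘ N).eval t = p.eval t := by
      intro t ht
      conv_rhs => rw [← hsplit]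
      have : N.eval t = 0 := Lagrange.eval_nodal_at_node (v := id) ht
      rw [eval_add, eval_mul, this, zero_mul, add_zero]
    rw [hLp, Lagrange.eq_interpolate hinj hrem, Lagrange.interpolate_apply, map_sum]
    refine Finset.sum_congr rfl fun t ht => ?_
    rw [← smul_eq_C_mul, map_smul, smul_eq_mul, id, heval t ht, mul_comm]
  refine ⟨S, fun t => L (Lagrange.basis S id t), hcard, hS, fun t ht => ?_, hexact⟩
  have hb0 := Lagrange.basis_ne_zero hinj ht
  -- The squared basis polynomial has degree `2 * n - 2`, so exactness applies and shows that `L` of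
  -- it is the weight at `t`.
  have hpos := hL (Lagrange.basis S id t * Lagrange.basis S id t)
    (fun x _ => by rw [eval_mul]; exact mul_self_nonneg _) (mul_ne_zero hb0 hb0)
  have hn : 0 < n := hcard ▸ Finset.card_pos.2 ⟨t, ht⟩
  have hbd := Lagrange.degree_basis hinj ht
  rw [hexact] at hpos
  · rw [Finset.sum_eq_single t] at hpos
    · have h1 : (Lagrange.basis S id t).eval t = 1 := Lagrange.eval_basis_self hinj ht
      rw [eval_mul, h1] at hpos
      simpa using hpos.le
    · intro u hu hut
      have h1 : (Lagrange.basis S id t).eval u = 0 :=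
        Lagrange.eval_basis_of_ne (v := id) hut.symm hu
      rw [eval_mul, h1]; simp
    · exact fun h => absurd ht h
  · rw [degree_mul, hbd, hcard]
    exact_mod_cast (show n - 1 + (n - 1) < 2 * n by omega)

/-- Gauss-Radau quadrature with a fixed node at `1`. -/
theorem IsPosFunctional.exists_radau {L : ℝ[X] →ₗ[ℝ] ℝ} (hL : IsPosFunctional L) (n : ℕ) :
    ∃ (S : Finset ℝ) (A : ℝ → ℝ) (W : ℝ), S.card = n ∧ (∀ t ∈ S, t ∈ Set.Ioo (0 : ℝ) 1) ∧
      (∀ t ∈ S, 0 ≤ A t) ∧ 0 ≤ W ∧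
      ∀ p : ℝ[X], p.degree ≤ ((2 * n : ℕ) : WithBot ℕ) →
        L p = ∑ t ∈ S, A t * p.eval t + W * p.eval 1 := by
  have hX1 : (1 - X : ℝ[X]) ≠ 0 := by
    intro h
    have := congrArg (eval 0) h
    simp at this
  -- The interior nodes are the Gauss nodes of the functional twisted by `1 - X`; its weights get
  -- divided by `1 - t`.
  have hL' : IsPosFunctional (L ∘ₗ LinearMap.mulLeft ℝ (1 - X : ℝ[X])) := by
    intro p hp hp0
    refine hL _ (fun t ht => ?_) (mul_ne_zero hX1 hp0)
    rw [LinearMap.mulLeft_apply, eval_mul]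
    exact mul_nonneg (by simpa using ht.2) (hp t ht)
  obtain ⟨S, A, hcard, hS, hA, hex⟩ := hL'.exists_gauss n
  have hne : ∀ t ∈ S, 1 - t ≠ 0 := fun t ht => by have := (hS t ht).2; linarith
  have hexact : ∀ p : ℝ[X], p.degree ≤ ((2 * n : ℕ) : WithBot ℕ) →
      L p = ∑ t ∈ S, A t / (1 - t) * p.eval t + (L 1 - ∑ t ∈ S, A t / (1 - t)) * p.eval 1 := by
    intro p hp
    obtain ⟨g, hg⟩ := X_sub_C_dvd_sub_C_eval (p := p) (a := (1 : ℝ))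
    have hp' : p = (1 - X) * (-g) + p.eval 1 • (1 : ℝ[X]) := by
      rw [smul_eq_C_mul, mul_one, ← sub_eq_iff_eq_add, hg, C_1]; ring
    have hgd : (-g).degree < ((2 * n : ℕ) : WithBot ℕ) := by
      by_cases hg0 : g = 0
      · rw [hg0, neg_zero, degree_zero]; exact WithBot.bot_lt_coe _
      have h1 : (p - C (p.eval 1)).degree ≤ ((2 * n : ℕ) : WithBot ℕ) :=
        (degree_sub_le _ _).trans (max_le hp (degree_C_le.trans (by exact_mod_cast Nat.zero_le _)))
      rw [hg, degree_mul, degree_X_sub_C, degree_eq_natDegree hg0] at h1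
      have h2 : 1 + g.natDegree ≤ 2 * n := by exact_mod_cast h1
      rw [degree_neg, degree_eq_natDegree hg0]
      exact_mod_cast (show g.natDegree < 2 * n by omega)
    have h1 := hex _ hgd
    simp only [LinearMap.comp_apply, LinearMap.mulLeft_apply] at h1
    have h2 : ∀ t ∈ S, A t * (-g).eval t = A t / (1 - t) * (p.eval t - p.eval 1) := by
      intro t ht
      have := congrArg (eval t) hp'
      simp only [eval_add, eval_mul, eval_sub, eval_one, eval_X, eval_smul, smul_eq_mul,
        mul_one] at this
      rw [this]
      have := hne t ht
      field_simp
      ring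
    conv_lhs => rw [hp']
    rw [map_add, map_smul, h1, Finset.sum_congr rfl h2, smul_eq_mul, sub_mul, Finset.sum_mul]
    simp only [mul_sub, Finset.sum_sub_distrib]
    ring
  refine ⟨S, fun t => A t / (1 - t), _, hcard, hS, fun t ht => ?_, ?_, hexact⟩
  · exact div_nonneg (hA t ht) (by have := (hS t ht).2; linarith)
  · set N := Lagrange.nodal S (id : ℝ → ℝ) with hN
    have hN0 : N ≠ 0 := Lagrange.nodal_ne_zero
    -- `N * N` vanishes at the interior nodes, which isolates the weight at `1`.
    have hpos := hL (N * N) (fun x _ => by rw [eval_mul]; exact mul_self_nonneg _)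
      (mul_ne_zero hN0 hN0)
    rw [hexact] at hpos
    · rw [Finset.sum_eq_zero, zero_add, eval_mul] at hpos
      · exact (pos_of_mul_pos_left hpos (mul_self_nonneg _)).le
      · intro t ht
        have : N.eval t = 0 := Lagrange.eval_nodal_at_node (v := id) ht
        rw [eval_mul, this]; simp
    · rw [degree_mul, hN, Lagrange.degree_nodal, hcard]
      exact_mod_cast (show n + n ≤ 2 * n by omega)

/-- The functional `p ↦ ∫₀¹ p(t) (1 - t) ^ a dt`. -/
noncomputable def jacobiFunctional (a : ℕ) : ℝ[X] →ₗ[ℝ] ℝ where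
  toFun p := ∫ t in (0 : ℝ)..1, p.eval t * (1 - t) ^ a
  map_add' p q := by
    rw [← intervalIntegral.integral_add]
    · simp [add_mul]
    all_goals exact (Continuous.intervalIntegrable (by fun_prop) _ _)
  map_smul' c p := by
    simp [mul_assoc]

theorem jacobiFunctional_apply (a : ℕ) (p : ℝ[X]) :
    jacobiFunctional a p = ∫ t in (0 : ℝ)..1, p.eval t * (1 - t) ^ a := rfl

theorem isPosFunctional_jacobiFunctional (a : ℕ) : IsPosFunctional (jacobiFunctional a) := by
  intro p hp hp0
  rw [jacobiFunctional_apply]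
  have hX1 : (1 - X : ℝ[X]) ≠ 0 := by
    intro h
    have := congrArg (eval 0) h
    simp at this
  have hq : p * (1 - X) ^ a ≠ 0 := mul_ne_zero hp0 (pow_ne_zero _ hX1)
  obtain ⟨c, hc, hc0⟩ : ∃ c ∈ Set.Icc (0 : ℝ) 1, (p * (1 - X) ^ a).eval c ≠ 0 := by
    by_contra h
    push Not at h
    refine hq (eq_zero_of_infinite_isRoot _ ((Set.Icc_infinite (zero_lt_one' ℝ)).mono h))
  have hev : ∀ x, (p * (1 - X) ^ a).eval x = p.eval x * (1 - x) ^ a := by intro x; simp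
  have hnn : ∀ x ∈ Set.Icc (0 : ℝ) 1, 0 ≤ p.eval x * (1 - x) ^ a := fun x hx =>
    mul_nonneg (hp x hx) (pow_nonneg (by linarith [hx.2]) _)
  refine intervalIntegral.integral_pos zero_lt_one (by fun_prop)
    (fun x hx => hnn x ⟨hx.1.le, hx.2⟩) ⟨c, hc, ?_⟩
  rw [hev] at hc0
  exact lt_of_le_of_ne (hnn c hc) hc0.symm

theorem integral_pow_mul_one_sub_pow (i j : ℕ) :
    ∫ t in (0 : ℝ)..1, t ^ i * (1 - t) ^ j =
      (i.factorial * j.factorial : ℝ) / (i + j + 1).factorial := by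
  have h := Complex.Gamma_mul_Gamma_eq_betaIntegral (s := (i : ℂ) + 1) (t := (j : ℂ) + 1)
    (by simp; positivity) (by simp; positivity)
  have e : (i : ℂ) + 1 + ((j : ℂ) + 1) = ((i + j + 1 : ℕ) : ℂ) + 1 := by push_cast; ring
  rw [e, Complex.Gamma_nat_eq_factorial, Complex.Gamma_nat_eq_factorial,
    Complex.Gamma_nat_eq_factorial] at h
  have h2 : Complex.betaIntegral ((i : ℂ) + 1) ((j : ℂ) + 1) =
      ((∫ t in (0 : ℝ)..1, t ^ i * (1 - t) ^ j : ℝ) : ℂ) := by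
    rw [Complex.betaIntegral, ← intervalIntegral.integral_ofReal]
    simp
  rw [h2] at h
  have h3 : (i.factorial * j.factorial : ℝ) =
      (i + j + 1).factorial * ∫ t in (0 : ℝ)..1, t ^ i * (1 - t) ^ j := by exact_mod_cast h
  rw [h3, mul_div_cancel_left₀]
  positivity

theorem jacobiFunctional_bernstein (a i j : ℕ) :
    jacobiFunctional a ((1 - X) ^ i * X ^ j) =
      (j.factorial * (i + a).factorial : ℝ) / (j + (i + a) + 1).factorial := by
  rw [jacobiFunctional_apply, ← integral_pow_mul_one_sub_pow]
  congr 1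
  ext t
  simp
  ring

theorem degree_bernstein_le {s i : ℕ} (hi : i ≤ s) :
    ((1 - X : ℝ[X]) ^ i * X ^ (s - i)).degree ≤ (s : WithBot ℕ) := by
  refine degree_le_of_natDegree_le (natDegree_mul_le.trans ?_)
  have h1 : (1 - X : ℝ[X]).natDegree ≤ 1 :=
    (natDegree_sub_le _ _).trans (by simp)
  have h2 := natDegree_pow_le_of_le i h1
  rw [natDegree_X_pow]
  omega

end Quadrature

/-! ### Averaging over roots of unity -/

section Averaging

open scoped ComplexConjugate

theorem IsPrimitiveRoot.norm_pow_eq_one {ζ : ℂ} {N : ℕ} (hζ : IsPrimitiveRoot ζ N) (hN : N ≠ 0)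
    (l : ℕ) : ‖ζ ^ l‖ = 1 := by
  rw [norm_pow, Complex.norm_eq_one_of_pow_eq_one hζ.pow_eq_one hN, one_pow]

theorem IsPrimitiveRoot.sum_pow_mul_conj {ζ : ℂ} {N : ℕ} (hζ : IsPrimitiveRoot ζ N)
    {i j : ℕ} (hi : i < N) (hj : j < N) :
    ∑ l ∈ Finset.range N, (ζ ^ i * conj (ζ ^ j)) ^ l = if i = j then (N : ℂ) else 0 := by
  have hN : N ≠ 0 := by omega
  have hc : ∀ k : ℕ, ζ ^ k * conj (ζ ^ k) = 1 := fun k => by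
    rw [Complex.mul_conj', hζ.norm_pow_eq_one hN]; simp
  split_ifs with h
  · subst h
    simp only [hc, one_pow]
    simp
  · have hne : ζ ^ i * conj (ζ ^ j) ≠ 1 := by
      intro h1
      apply h
      apply hζ.pow_inj hi hj
      calc ζ ^ i = ζ ^ i * (ζ ^ j * conj (ζ ^ j)) := by rw [hc, mul_one]
        _ = (ζ ^ i * conj (ζ ^ j)) * ζ ^ j := by ring
        _ = ζ ^ j := by rw [h1, one_mul]
    have hp : (ζ ^ i * conj (ζ ^ j)) ^ N = 1 := by
      rw [mul_pow, ← map_pow, ← pow_mul, ← pow_mul, mul_comm i, mul_comm j, pow_mul, pow_mul,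
        hζ.pow_eq_one]
      simp
    rw [geom_sum_eq hne, hp, sub_self, zero_div]

/-- Parseval's identity on the cyclic group of order `N`. -/
theorem IsPrimitiveRoot.sum_norm_sq {ζ : ℂ} {N : ℕ} (hζ : IsPrimitiveRoot ζ N) (c : ℕ → ℂ) :
    ∑ l ∈ Finset.range N, ‖∑ i ∈ Finset.range N, c i * (ζ ^ l) ^ i‖ ^ 2 =
      N * ∑ i ∈ Finset.range N, ‖c i‖ ^ 2 := by
  have key : ∑ l ∈ Finset.range N, ((‖∑ i ∈ Finset.range N, c i * (ζ ^ l) ^ i‖ : ℂ)) ^ 2 =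
      N * ∑ i ∈ Finset.range N, (‖c i‖ : ℂ) ^ 2 := by
    simp only [← Complex.mul_conj']
    calc _ = ∑ l ∈ Finset.range N, ∑ i ∈ Finset.range N, ∑ j ∈ Finset.range N,
          c i * conj (c j) * (ζ ^ i * conj (ζ ^ j)) ^ l := by
          refine Finset.sum_congr rfl fun l _ => ?_
          rw [map_sum, Finset.sum_mul_sum]
          refine Finset.sum_congr rfl fun i _ => Finset.sum_congr rfl fun j _ => ?_
          simp only [map_mul, map_pow, mul_pow, ← pow_mul]
          rw [mul_comm l i, mul_comm l j]
          ring
      _ = ∑ i ∈ Finset.range N, ∑ j ∈ Finset.range N,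
          c i * conj (c j) * ∑ l ∈ Finset.range N, (ζ ^ i * conj (ζ ^ j)) ^ l := by
          rw [Finset.sum_comm]
          refine Finset.sum_congr rfl fun i _ => ?_
          rw [Finset.sum_comm]
          simp only [Finset.mul_sum]
      _ = ∑ i ∈ Finset.range N, c i * conj (c i) * N := by
          refine Finset.sum_congr rfl fun i hi => ?_
          rw [Finset.sum_eq_single i]
          · rw [hζ.sum_pow_mul_conj (Finset.mem_range.1 hi) (Finset.mem_range.1 hi), if_pos rfl]
          · intro j hj hji
            rw [hζ.sum_pow_mul_conj (Finset.mem_range.1 hi) (Finset.mem_range.1 hj),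
              if_neg hji.symm, mul_zero]
          · exact fun h => absurd hi h
      _ = _ := by rw [Finset.mul_sum]; exact Finset.sum_congr rfl fun i _ => mul_comm _ _
  exact_mod_cast key

/-- Averaging `‖a ω + b‖ ^ (2 * s)` over the `(s + 1)`-th roots of unity `ω`. -/
theorem IsPrimitiveRoot.sum_norm_pow {ζ : ℂ} {s : ℕ} (hζ : IsPrimitiveRoot ζ (s + 1)) (a b : ℂ) :
    ∑ l ∈ Finset.range (s + 1), ‖ζ ^ l * a + b‖ ^ (2 * s) =
      (s + 1) * ∑ i ∈ Finset.range (s + 1),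
        (s.choose i : ℝ) ^ 2 * ‖a‖ ^ (2 * i) * ‖b‖ ^ (2 * (s - i)) := by
  have h := hζ.sum_norm_sq (fun i => a ^ i * b ^ (s - i) * s.choose i)
  have e : ∀ l, ∑ i ∈ Finset.range (s + 1), a ^ i * b ^ (s - i) * s.choose i * (ζ ^ l) ^ i =
      (ζ ^ l * a + b) ^ s := by
    intro l
    rw [add_pow]
    refine Finset.sum_congr rfl fun i _ => ?_
    rw [mul_pow]; ring
  simp only [e] at h
  have e2 : ∀ l, ‖ζ ^ l * a + b‖ ^ (2 * s) = ‖(ζ ^ l * a + b) ^ s‖ ^ 2 := by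
    intro l; rw [norm_pow, ← pow_mul, mul_comm s]
  simp only [e2, h]
  push_cast
  congr 1
  refine Finset.sum_congr rfl fun i _ => ?_
  rw [norm_mul, norm_mul, norm_pow, norm_pow, Complex.norm_natCast]
  ring

/-- Comparison of coefficients: the exponents are distinct for `i ≤ s`. -/
theorem eq_zero_of_sum_mul_pow_eq_zero {s : ℕ} (d : ℕ → ℝ)
    (h : ∀ ε : ℝ, ∑ i ∈ Finset.range (s + 1), d i * ε ^ (2 * (s - i)) = 0) {i : ℕ} (hi : i ≤ s) :
    d i = 0 := by
  classical
  set p : Polynomial ℝ :=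
    ∑ i ∈ Finset.range (s + 1), Polynomial.C (d i) * Polynomial.X ^ (2 * (s - i)) with hp
  have h0 : p = 0 := by
    refine Polynomial.funext fun ε => ?_
    rw [hp, Polynomial.eval_finsetSum]
    simpa using h ε
  have hc : p.coeff (2 * (s - i)) = d i := by
    rw [hp, Polynomial.finsetSum_coeff, Finset.sum_eq_single i]
    · rw [Polynomial.coeff_C_mul_X_pow, if_pos rfl]
    · intro j hj hji
      have := Finset.mem_range.1 hj
      rw [Polynomial.coeff_C_mul_X_pow, if_neg (by omega)]
    · exact fun h => absurd (Finset.mem_range.2 (by omega)) h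
  rw [← hc, h0, Polynomial.coeff_zero]

end Averaging

/-! ### Lower moments of a system of vectors -/

section Descent

variable {E : Type*} [NormedAddCommGroup E] [InnerProductSpace ℂ E] {ι : Type*} [Fintype ι]

local notation "⟪" x ", " y "⟫" => inner ℂ x y

/-- Polarization: put `ζ ^ l • y + ε • z` into `h`, sum over `l`, and compare coefficients of powers
of `ε`. Orthogonality makes the right side independent of `l`. -/
theorem sum_norm_inner_pow_orthogonal {w : ι → ℝ} {v : ι → E} {c : ℝ} {s : ℕ}
    (h : ∀ y, ∑ k, w k * ‖⟪v k, y⟫‖ ^ (2 * s) = c * ‖y‖ ^ (2 * s))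
    {y z : E} (hyz : ⟪y, z⟫ = 0) {i : ℕ} (hi : i ≤ s) :
    s.choose i * ∑ k, w k * (‖⟪v k, y⟫‖ ^ (2 * i) * ‖⟪v k, z⟫‖ ^ (2 * (s - i))) =
      c * (‖y‖ ^ (2 * i) * ‖z‖ ^ (2 * (s - i))) := by
  obtain ⟨ζ, hζ⟩ : ∃ ζ : ℂ, IsPrimitiveRoot ζ (s + 1) :=
    ⟨_, Complex.isPrimitiveRoot_exp (s + 1) (by omega)⟩
  have key := eq_zero_of_sum_mul_pow_eq_zero (s := s)
    (fun i => (s.choose i : ℝ) ^ 2 *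
        ∑ k, w k * (‖⟪v k, y⟫‖ ^ (2 * i) * ‖⟪v k, z⟫‖ ^ (2 * (s - i))) -
      s.choose i * (c * (‖y‖ ^ (2 * i) * ‖z‖ ^ (2 * (s - i))))) ?_ hi
  · have hch : (s.choose i : ℝ) ≠ 0 := by exact_mod_cast (Nat.choose_pos hi).ne'
    have : (s.choose i : ℝ) * (s.choose i *
        ∑ k, w k * (‖⟪v k, y⟫‖ ^ (2 * i) * ‖⟪v k, z⟫‖ ^ (2 * (s - i))) -
        c * (‖y‖ ^ (2 * i) * ‖z‖ ^ (2 * (s - i)))) = 0 := by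
      rw [← key]; ring
    exact sub_eq_zero.1 ((mul_eq_zero.1 this).resolve_left hch)
  · intro ε
    have hnorm : ∀ l, ‖ζ ^ l • y + (ε : ℂ) • z‖ ^ (2 * s) =
        ∑ i ∈ Finset.range (s + 1),
          s.choose i * (‖y‖ ^ (2 * i) * ‖z‖ ^ (2 * (s - i))) * ε ^ (2 * (s - i)) := by
      intro l
      have h0 : ⟪ζ ^ l • y, (ε : ℂ) • z⟫ = 0 := by
        rw [inner_smul_left, inner_smul_right, hyz, mul_zero, mul_zero]
      have h1 := norm_add_sq_eq_norm_sq_add_norm_sq_of_inner_eq_zero _ _ h0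
      rw [pow_mul, sq, h1, norm_smul, norm_smul, hζ.norm_pow_eq_one (by omega), one_mul,
        Complex.norm_real, Real.norm_eq_abs, add_pow]
      refine Finset.sum_congr rfl fun i _ => ?_
      rw [pow_mul, pow_mul, pow_mul ε, ← sq_abs ε, ← sq, ← sq, mul_pow, mul_pow]
      ring
    have hsum : ∑ l ∈ Finset.range (s + 1), ∑ k, w k * ‖⟪v k, ζ ^ l • y + (ε : ℂ) • z⟫‖ ^ (2 * s) =
        ∑ l ∈ Finset.range (s + 1), c * ‖ζ ^ l • y + (ε : ℂ) • z‖ ^ (2 * s) :=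
      Finset.sum_congr rfl fun l _ => h _
    rw [Finset.sum_comm] at hsum
    simp only [hnorm, Finset.sum_const, Finset.card_range, ← Finset.mul_sum, inner_add_right,
      inner_smul_right, hζ.sum_norm_pow, nsmul_eq_mul] at hsum
    have hs0 : (s + 1 : ℝ) ≠ 0 := by positivity
    have hsum2 : (s + 1 : ℝ) * (∑ k, w k * ∑ i ∈ Finset.range (s + 1),
          (s.choose i : ℝ) ^ 2 * ‖⟪v k, y⟫‖ ^ (2 * i) * ‖(ε : ℂ) * ⟪v k, z⟫‖ ^ (2 * (s - i))) =
        (s + 1) * (c * ∑ i ∈ Finset.range (s + 1),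
          s.choose i * (‖y‖ ^ (2 * i) * ‖z‖ ^ (2 * (s - i))) * ε ^ (2 * (s - i))) := by
      push_cast at hsum
      rw [← hsum, Finset.mul_sum]
      exact Finset.sum_congr rfl fun k _ => by ring
    have hsum3 := mul_left_cancel₀ hs0 hsum2
    simp only [sub_mul, Finset.sum_sub_distrib, sub_eq_zero]
    calc _ = ∑ k, w k * ∑ i ∈ Finset.range (s + 1),
          (s.choose i : ℝ) ^ 2 * ‖⟪v k, y⟫‖ ^ (2 * i) * ‖(ε : ℂ) * ⟪v k, z⟫‖ ^ (2 * (s - i)) := by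
          simp only [Finset.mul_sum, Finset.sum_mul]
          rw [Finset.sum_comm]
          refine Finset.sum_congr rfl fun k _ => Finset.sum_congr rfl fun i _ => ?_
          rw [norm_mul, Complex.norm_real, Real.norm_eq_abs, mul_pow, pow_mul |ε|, sq_abs,
            ← pow_mul]
          ring
      _ = _ := by
          rw [hsum3, Finset.mul_sum]
          exact Finset.sum_congr rfl fun i _ => by ring

/-- Expand `‖v k‖ ^ 2` in an orthonormal basis through `y / ‖y‖`. After multiplication by `j + 1`,
the direction of `y` contributes `c * (j + 1)` and each of the `d` others contributes `c`. -/
theorem sum_norm_sq_mul_norm_inner_pow [FiniteDimensional ℂ E] {w : ι → ℝ} {v : ι → E} {c : ℝ}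
    {j d : ℕ} (hd : Module.finrank ℂ E = d + 1)
    (h : ∀ y, ∑ k, w k * ‖⟪v k, y⟫‖ ^ (2 * (j + 1)) = c * ‖y‖ ^ (2 * (j + 1))) (y : E) :
    (j + 1) * ∑ k, w k * ‖v k‖ ^ 2 * ‖⟪v k, y⟫‖ ^ (2 * j) =
      c * (j + d + 1) * ‖y‖ ^ (2 * j) := by
  have main : ∀ y : E, y ≠ 0 → (j + 1) * ∑ k, w k * ‖v k‖ ^ 2 * ‖⟪v k, y⟫‖ ^ (2 * j) =
      c * (j + d + 1) * ‖y‖ ^ (2 * j) := by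
    intro y hy
    have hy' : ‖y‖ ≠ 0 := norm_ne_zero_iff.2 hy
    obtain ⟨b, hb⟩ := Orthonormal.exists_orthonormalBasis_extension_of_card_eq (𝕜 := ℂ)
      (ι := Fin (d + 1)) (by simpa using hd)
      (v := fun _ => ((‖y‖⁻¹ : ℝ) : ℂ) • y) (s := {0}) (by
        refine ⟨fun i => ?_, fun i i' hii => (hii (Subsingleton.elim _ _)).elim⟩
        simp [norm_smul, hy'])
    have hb0 : b 0 = ((‖y‖⁻¹ : ℝ) : ℂ) • y := hb 0 rfl
    have hyb : y = (‖y‖ : ℂ) • b 0 := by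
      rw [hb0, smul_smul]; simp [hy']
    have hv : ∀ k, ‖v k‖ ^ 2 = ∑ i, ‖⟪v k, b i⟫‖ ^ 2 := fun k => (b.sum_sq_norm_inner_left _).symm
    have hother : ∀ i : Fin d, (j + 1) * ∑ k, w k *
        (‖⟪v k, y⟫‖ ^ (2 * j) * ‖⟪v k, b i.succ⟫‖ ^ 2) = c * ‖y‖ ^ (2 * j) := by
      intro i
      have h0 : ⟪y, b i.succ⟫ = 0 := by
        rw [hyb, inner_smul_left, b.orthonormal.2 (Fin.succ_ne_zero i).symm, mul_zero]
      have := sum_norm_inner_pow_orthogonal h h0 (Nat.le_succ j)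
      simpa [b.orthonormal.1] using this
    have hzero : ∑ k, w k * (‖⟪v k, y⟫‖ ^ (2 * j) * ‖⟪v k, b 0⟫‖ ^ 2) = c * ‖y‖ ^ (2 * j) := by
      have h2 : ∀ k, ‖⟪v k, y⟫‖ ^ 2 = ‖y‖ ^ 2 * ‖⟪v k, b 0⟫‖ ^ 2 := by
        intro k
        conv_lhs => rw [hyb, inner_smul_right, norm_mul, mul_pow, Complex.norm_real, norm_norm]
      refine mul_left_cancel₀ (pow_ne_zero 2 hy') ?_
      have := h y
      simp only [mul_add, mul_one, pow_add] at this
      calc _ = ∑ k, w k * (‖⟪v k, y⟫‖ ^ (2 * j) * ‖⟪v k, y⟫‖ ^ 2) := by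
            rw [Finset.mul_sum]
            exact Finset.sum_congr rfl fun k _ => by rw [h2]; ring
        _ = _ := by rw [this]; ring
    calc _ = (j + 1) * ∑ k, w k * (‖⟪v k, y⟫‖ ^ (2 * j) * ‖⟪v k, b 0⟫‖ ^ 2) +
          ∑ i : Fin d, (j + 1) * ∑ k, w k * (‖⟪v k, y⟫‖ ^ (2 * j) * ‖⟪v k, b i.succ⟫‖ ^ 2) := by
          rw [← Finset.mul_sum, ← mul_add, Finset.sum_comm, ← Finset.sum_add_distrib]
          congr 1
          refine Finset.sum_congr rfl fun k _ => ?_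
          rw [hv, Fin.sum_univ_succ, ← Finset.mul_sum, ← Finset.mul_sum]
          ring
      _ = _ := by
          rw [hzero, Finset.sum_congr rfl fun i _ => hother i]
          simp
          ring
  rcases eq_or_ne y 0 with rfl | hy
  -- For `j = 0` neither side depends on `y`, so any nonzero vector serves.
  · rcases Nat.eq_zero_or_pos j with rfl | hj
    · have : Nontrivial E := Module.nontrivial_of_finrank_pos (R := ℂ) (by omega)
      obtain ⟨z, hz⟩ := exists_ne (0 : E)
      simpa using main z hz
    · have : 2 * j ≠ 0 := by omega
      simp [this]
  · exact main y hy

/-- The lower even moments of a system of vectors are determined by the `2 * s`-th one. -/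
theorem sum_norm_pow_mul_norm_inner_pow [FiniteDimensional ℂ E] {v : ι → E}
    {s d : ℕ} (hd : Module.finrank ℂ E = d + 1)
    (h : ∀ y, ∑ k, ‖⟪v k, y⟫‖ ^ (2 * s) = ‖y‖ ^ (2 * s)) {i : ℕ} (hi : i ≤ s) (y : E) :
    ∑ k, ‖v k‖ ^ (2 * (s - i)) * ‖⟪v k, y⟫‖ ^ (2 * i) =
      ((s + d).factorial * i.factorial : ℝ) / (s.factorial * (i + d).factorial) *
        ‖y‖ ^ (2 * i) := by
  induction hi using Nat.decreasingInduction generalizing y with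
  | self =>
    rw [mul_comm ((s + d).factorial : ℝ), div_self (by positivity)]
    simpa using h y
  | of_succ i hi ih =>
    have := sum_norm_sq_mul_norm_inner_pow hd ih y
    have hi1 : (i + 1 : ℝ) ≠ 0 := by positivity
    refine mul_left_cancel₀ hi1 ?_
    calc _ = (i + 1 : ℝ) * ∑ k, ‖v k‖ ^ (2 * (s - (i + 1))) * ‖v k‖ ^ 2 * ‖⟪v k, y⟫‖ ^ (2 * i) := by
          congr 1
          refine Finset.sum_congr rfl fun k _ => ?_
          rw [← pow_add]
          congr 2
          omega
      _ = _ := by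
          rw [this, show i + 1 + d = (i + d) + 1 by ring, Nat.factorial_succ, Nat.factorial_succ]
          push_cast
          have : (i + d + 1 : ℝ) ≠ 0 := by positivity
          field_simp

end Descent

/-! ### Raising the dimension by one -/

section Embedding

local notation "⟪" x ", " y "⟫" => inner ℂ x y

theorem PiLp.norm_natCast_pow {n p : ℕ} (hp : p ≠ 0) (x : PiLp (p : ℝ≥0∞) (fun _ : Fin n => ℂ)) :
    ‖x‖ ^ p = ∑ k, ‖x k‖ ^ p := by
  have hp' : (0 : ℝ) < p := by exact_mod_cast Nat.pos_of_ne_zero hp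
  rw [PiLp.norm_eq_sum (by simpa using Nat.pos_of_ne_zero hp), ENNReal.toReal_natCast, one_div,
    ← Real.rpow_natCast, ← Real.rpow_mul (Finset.sum_nonneg fun _ _ => by positivity),
    inv_mul_cancel₀ hp'.ne', Real.rpow_one]
  simp only [Real.rpow_natCast]

theorem HasComplexEmbedding.exists_vectors {m p n : ℕ} (hp : p ≠ 0)
    (h : HasComplexEmbedding m p n) :
    ∃ v : Fin n → EuclideanSpace ℂ (Fin m), ∀ y, ∑ k, ‖⟪v k, y⟫‖ ^ p = ‖y‖ ^ p := by
  obtain ⟨f, hf⟩ := h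
  refine ⟨fun k => (InnerProductSpace.toDual ℂ _).symm (LinearMap.toContinuousLinearMap
    ((PiLp.projₗ (p : ℝ≥0∞) (fun _ : Fin n => ℂ) k).comp f)), fun y => ?_⟩
  rw [← hf y, PiLp.norm_natCast_pow hp]
  simp

/-- Nonnegative weights are absorbed into the functionals as `p`-th roots. -/
theorem hasComplexEmbedding_of_sum {m p : ℕ} (hp : p ≠ 0) {ι : Type*} [Fintype ι] (w : ι → ℝ)
    (hw : ∀ k, 0 ≤ w k) (g : ι → EuclideanSpace ℂ (Fin m) →ₗ[ℂ] ℂ)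
    (h : ∀ y, ∑ k, w k * ‖g k y‖ ^ p = ‖y‖ ^ p) :
    HasComplexEmbedding m p (Fintype.card ι) := by
  let e := Fintype.equivFin ι
  refine ⟨(WithLp.linearEquiv (p : ℝ≥0∞) ℂ (Fin (Fintype.card ι) → ℂ)).symm.toLinearMap ∘ₗ
    LinearMap.pi (fun k => (((w (e.symm k)) ^ ((p : ℝ)⁻¹) : ℝ) : ℂ) • g (e.symm k)),
    fun y => ?_⟩
  have : Fact (1 ≤ (p : ℝ≥0∞)) := ⟨by exact_mod_cast Nat.one_le_iff_ne_zero.2 hp⟩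
  refine (pow_left_inj₀ (norm_nonneg _) (norm_nonneg _) hp).1 ?_
  rw [PiLp.norm_natCast_pow hp, ← h y, ← e.symm.sum_comp]
  refine Finset.sum_congr rfl fun k _ => ?_
  have hn := Real.rpow_inv_natCast_pow (hw (e.symm k)) hp
  have h0 : (0 : ℝ) ≤ w (e.symm k) ^ ((p : ℝ)⁻¹) := Real.rpow_nonneg (hw _) _
  change ‖((w (e.symm k) ^ ((p : ℝ)⁻¹) : ℝ) : ℂ) * g (e.symm k) y‖ ^ p = _
  rw [norm_mul, mul_pow, Complex.norm_real, Real.norm_of_nonneg h0, hn]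

/-- The projection `ℂ^(m + 1) → ℂ^m` forgetting the last coordinate. -/
noncomputable def euclideanInit (m : ℕ) :
    EuclideanSpace ℂ (Fin (m + 1)) →ₗ[ℂ] EuclideanSpace ℂ (Fin m) :=
  (WithLp.linearEquiv 2 ℂ (Fin m → ℂ)).symm.toLinearMap ∘ₗ LinearMap.funLeft ℂ ℂ Fin.castSucc ∘ₗ
    (WithLp.linearEquiv 2 ℂ (Fin (m + 1) → ℂ)).toLinearMap

theorem norm_sq_eq_euclideanInit {m : ℕ} (y : EuclideanSpace ℂ (Fin (m + 1))) :
    ‖y‖ ^ 2 = ‖euclideanInit m y‖ ^ 2 + ‖y (Fin.last m)‖ ^ 2 := by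
  rw [EuclideanSpace.norm_sq_eq, EuclideanSpace.norm_sq_eq, Fin.sum_univ_castSucc]
  rfl

set_option maxHeartbeats 400000 in
/-- A quadrature formula for the Jacobi weight `(1 - t) ^ a` with nodes `S` and poles `κ` turns an
embedding of `ℓ₂^(a + 1)` into one of `ℓ₂^(a + 2)`. -/
theorem HasComplexEmbedding.succ_of_quadrature {a s n e : ℕ} (hs : s ≠ 0)
    (h : HasComplexEmbedding (a + 1) (2 * s) n) (S : Finset ℝ) (A : ℝ → ℝ) (W : Fin e → ℝ)
    (hS : ∀ t ∈ S, t ∈ Set.Ioo (0 : ℝ) 1) (hA : ∀ t ∈ S, 0 ≤ A t) (hW : ∀ q, 0 ≤ W q)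
    (hq : ∀ i ≤ s, ∑ t ∈ S, A t * ((1 - t) ^ i * t ^ (s - i)) + (∑ q, W q) * 0 ^ i =
      ((s - i).factorial * (i + a).factorial : ℝ) / (s + a + 1).factorial) :
    HasComplexEmbedding (a + 1 + 1) (2 * s) (S.card * ((s + 1) * n) + e) := by
  have hp : 2 * s ≠ 0 := by omega
  obtain ⟨v, hv⟩ := h.exists_vectors hp
  obtain ⟨ζ, hζ⟩ : ∃ ζ : ℂ, IsPrimitiveRoot ζ (s + 1) :=
    ⟨_, Complex.isPrimitiveRoot_exp (s + 1) (by omega)⟩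
  have hmom := fun i (hi : i ≤ s) (y : EuclideanSpace ℂ (Fin (a + 1))) =>
    sum_norm_pow_mul_norm_inner_pow (d := a) (by simp) hv hi y
  set M : ℕ → ℝ := fun i =>
    ((s + a).factorial * i.factorial : ℝ) / (s.factorial * (i + a).factorial) with hM
  -- Averaging yields the square of the binomial coefficient; moment and Beta value cancel one
  -- factor up to the constant `s + a + 1`.
  have hcoef : ∀ i ≤ s, (s + a + 1) * ((s.choose i : ℝ) * M i *
      (((s - i).factorial * (i + a).factorial : ℝ) / (s + a + 1).factorial)) = 1 := by
    intro i hi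
    rw [Nat.cast_choose ℝ hi, Nat.factorial_succ (s + a), hM]
    push_cast
    have : (s + a + 1 : ℝ) ≠ 0 := by positivity
    field_simp
  have hcard : Fintype.card ((S × Fin (s + 1) × Fin n) ⊕ Fin e) = S.card * ((s + 1) * n) + e := by
    simp
  rw [← hcard]
  refine hasComplexEmbedding_of_sum hp
    -- The divisor `s + 1` offsets the number of roots of unity. At a pole, `M 0 = ∑ ‖v k‖ ^ (2 *
    -- s)` accounts for the merged functionals.
    (Sum.elim (fun x => (s + a + 1) / (s + 1) * A x.1) (fun q => (s + a + 1) * M 0 * W q)) ?_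
    (Sum.elim
      (fun x => (ζ ^ (x.2.1 : ℕ) * (√(1 - x.1) : ℂ)) •
          ((innerSL ℂ (v x.2.2)).toLinearMap ∘ₗ euclideanInit (a + 1)) +
        ((√(x.1 : ℝ) : ℂ) * (‖v x.2.2‖ : ℂ)) •
          PiLp.projₗ 2 (fun _ : Fin (a + 1 + 1) => ℂ) (Fin.last (a + 1)))
      (fun _ => PiLp.projₗ 2 (fun _ : Fin (a + 1 + 1) => ℂ) (Fin.last (a + 1)))) ?_
  · rintro (x | q)
    · exact mul_nonneg (by positivity) (hA _ x.1.2)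
    · have : 0 ≤ M 0 := by simp only [hM]; positivity
      exact mul_nonneg (by positivity) (hW q)
  intro y
  rw [Fintype.sum_sum_type, Fintype.sum_prod_type]
  simp only [Fintype.sum_prod_type, Sum.elim_inl, Sum.elim_inr, LinearMap.add_apply,
    LinearMap.smul_apply, LinearMap.comp_apply, ContinuousLinearMap.coe_coe, innerSL_apply_apply,
    PiLp.projₗ_apply, smul_eq_mul]
  set z := euclideanInit (a + 1) y with hz
  set η := y (Fin.last (a + 1)) with hη
  have hnode : ∀ t ∈ S, ∑ l : Fin (s + 1), ∑ k, (s + a + 1 : ℝ) / (s + 1) * A t *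
      ‖ζ ^ (l : ℕ) * (√(1 - t) : ℂ) * ⟪v k, z⟫ + (√t : ℂ) * (‖v k‖ : ℂ) * η‖ ^ (2 * s) =
      (s + a + 1) * ∑ i ∈ Finset.range (s + 1), (s.choose i : ℝ) ^ 2 * M i *
        (A t * ((1 - t) ^ i * t ^ (s - i))) * (‖z‖ ^ (2 * i) * ‖η‖ ^ (2 * (s - i))) := by
    intro t ht
    have ht1 : 0 ≤ 1 - t := by linarith [(hS t ht).2]
    have ht0 : 0 ≤ t := (hS t ht).1.le
    rw [Finset.sum_comm]
    have hs0 : (s + 1 : ℝ) ≠ 0 := by positivity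
    calc _ = ∑ k, (s + a + 1 : ℝ) / (s + 1) * A t * ∑ l ∈ Finset.range (s + 1),
          ‖ζ ^ l * ((√(1 - t) : ℂ) * ⟪v k, z⟫) + (√t : ℂ) * (‖v k‖ : ℂ) * η‖ ^ (2 * s) := by
          refine Finset.sum_congr rfl fun k _ => ?_
          rw [Finset.mul_sum, ← Fin.sum_univ_eq_sum_range (fun l => (s + a + 1 : ℝ) / (s + 1) * A t *
            ‖ζ ^ l * ((√(1 - t) : ℂ) * ⟪v k, z⟫) + (√t : ℂ) * (‖v k‖ : ℂ) * η‖ ^ (2 * s))]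
          simp only [mul_assoc]
      _ = ∑ k, ∑ i ∈ Finset.range (s + 1), (s + a + 1 : ℝ) * A t * ((s.choose i : ℝ) ^ 2 *
          ((1 - t) ^ i * t ^ (s - i)) * (‖v k‖ ^ (2 * (s - i)) * ‖⟪v k, z⟫‖ ^ (2 * i)) *
            ‖η‖ ^ (2 * (s - i))) := by
          refine Finset.sum_congr rfl fun k _ => ?_
          rw [hζ.sum_norm_pow, Finset.mul_sum, Finset.mul_sum]
          refine Finset.sum_congr rfl fun i _ => ?_
          have e1 : ‖(√(1 - t) : ℂ) * ⟪v k, z⟫‖ ^ (2 * i) =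
              (1 - t) ^ i * ‖⟪v k, z⟫‖ ^ (2 * i) := by
            rw [norm_mul, mul_pow, Complex.norm_real, Real.norm_of_nonneg (Real.sqrt_nonneg _),
              pow_mul, Real.sq_sqrt ht1]
          have e2 : ‖(√t : ℂ) * (‖v k‖ : ℂ) * η‖ ^ (2 * (s - i)) =
              t ^ (s - i) * ‖v k‖ ^ (2 * (s - i)) * ‖η‖ ^ (2 * (s - i)) := by
            rw [norm_mul, norm_mul, mul_pow, mul_pow, Complex.norm_real, Complex.norm_real,
              Real.norm_of_nonneg (Real.sqrt_nonneg _), norm_norm, pow_mul, Real.sq_sqrt ht0]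
          rw [e1, e2]
          field_simp
      _ = _ := by
          rw [Finset.sum_comm, Finset.mul_sum]
          refine Finset.sum_congr rfl fun i hi => ?_
          have := hmom i (Nat.lt_succ_iff.1 (Finset.mem_range.1 hi)) z
          rw [← Finset.mul_sum, ← Finset.sum_mul, ← Finset.mul_sum, this]
          ring
  have hpole : ∑ q, (s + a + 1) * M 0 * W q * ‖η‖ ^ (2 * s) =
      (s + a + 1) * ∑ i ∈ Finset.range (s + 1), (s.choose i : ℝ) ^ 2 * M i *
        ((∑ q, W q) * 0 ^ i) * (‖z‖ ^ (2 * i) * ‖η‖ ^ (2 * (s - i))) := by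
    rw [Finset.sum_eq_single (s := Finset.range (s + 1)) 0]
    · rw [← Finset.sum_mul, ← Finset.mul_sum]
      simp
      ring
    · intro i _ hi
      simp [hi]
    · simp
  rw [Finset.sum_coe_sort S (fun t => ∑ l : Fin (s + 1), ∑ k, (s + a + 1 : ℝ) / (s + 1) * A t *
      ‖ζ ^ (l : ℕ) * (√(1 - t) : ℂ) * ⟪v k, z⟫ + (√t : ℂ) * (‖v k‖ : ℂ) * η‖ ^ (2 * s)),
    Finset.sum_congr rfl hnode, hpole, ← Finset.mul_sum, Finset.sum_comm, ← mul_add,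
    ← Finset.sum_add_distrib, Finset.mul_sum, pow_mul, norm_sq_eq_euclideanInit, add_pow]
  refine Finset.sum_congr rfl fun i hi => ?_
  have hi' : i ≤ s := Nat.lt_succ_iff.1 (Finset.mem_range.1 hi)
  rw [← Finset.sum_mul, ← Finset.mul_sum, ← add_mul, ← mul_add, hq i hi', ← pow_mul, ← pow_mul]
  have := hcoef i hi'
  linear_combination (s.choose i : ℝ) * (‖z‖ ^ (2 * i) * ‖η‖ ^ (2 * (s - i))) * this

theorem HasComplexEmbedding.succ_of_odd {a r n : ℕ}
    (h : HasComplexEmbedding (a + 1) (2 * (2 * r + 1)) n) :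
    HasComplexEmbedding (a + 1 + 1) (2 * (2 * r + 1)) ((r + 1) * ((2 * r + 1 + 1) * n)) := by
  obtain ⟨S, A, hcard, hS, hA, hex⟩ := (isPosFunctional_jacobiFunctional a).exists_gauss (r + 1)
  have := h.succ_of_quadrature (by omega) S A (Fin.elim0 : Fin 0 → ℝ) hS hA (fun q => q.elim0) ?_
  · rwa [hcard] at this
  · intro i hi
    have h1 := hex ((1 - Polynomial.X) ^ i * Polynomial.X ^ (2 * r + 1 - i))
      (lt_of_le_of_lt (degree_bernstein_le hi) (by exact_mod_cast (by omega)))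
    rw [jacobiFunctional_bernstein,
      show 2 * r + 1 - i + (i + a) + 1 = 2 * r + 1 + a + 1 by omega] at h1
    rw [h1]
    simp

/-- Gauss would need `r + 1` nodes for degree `2 * r`; Radau trades one full node for a single
functional. -/
theorem HasComplexEmbedding.succ_of_even {a r n : ℕ} (hr : r ≠ 0)
    (h : HasComplexEmbedding (a + 1) (2 * (2 * r)) n) :
    HasComplexEmbedding (a + 1 + 1) (2 * (2 * r)) (r * ((2 * r + 1) * n) + 1) := by
  obtain ⟨S, A, W, hcard, hS, hA, hW, hex⟩ :=
    (isPosFunctional_jacobiFunctional a).exists_radau r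
  have := h.succ_of_quadrature (by omega) S A (fun _ : Fin 1 => W) hS hA (fun _ => hW) ?_
  · rwa [hcard] at this
  · intro i hi
    have h1 := hex ((1 - Polynomial.X) ^ i * Polynomial.X ^ (2 * r - i)) (degree_bernstein_le hi)
    rw [jacobiFunctional_bernstein, show 2 * r - i + (i + a) + 1 = 2 * r + a + 1 by omega] at h1
    rw [h1]
    simp

/-! ### Existence and bounds for the minimum -/

theorem hasComplexEmbedding_one {p : ℕ} (hp : p ≠ 0) : HasComplexEmbedding 1 p 1 := by
  have := hasComplexEmbedding_of_sum hp (fun _ : Fin 1 => 1) (fun _ => zero_le_one)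
    (fun _ => PiLp.projₗ 2 (fun _ : Fin 1 => ℂ) 0) (fun y => by
      simp [EuclideanSpace.norm_eq])
  simpa using this

theorem exists_hasComplexEmbedding {s : ℕ} (hs : 2 ≤ s) {m : ℕ} (hm : 1 ≤ m) :
    ∃ n, HasComplexEmbedding m (2 * s) n := by
  induction m, hm using Nat.le_induction with
  | base => exact ⟨1, hasComplexEmbedding_one (by omega)⟩
  | succ m hm ih =>
    obtain ⟨n, hn⟩ := ih
    obtain ⟨a, rfl⟩ := Nat.exists_eq_add_of_le' hm
    rcases Nat.even_or_odd' s with ⟨r, rfl | rfl⟩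
    · exact ⟨_, hn.succ_of_even (by omega)⟩
    · exact ⟨_, hn.succ_of_odd⟩

theorem HasComplexEmbedding.NC_le {m p n : ℕ} (h : HasComplexEmbedding m p n) : NC m p ≤ n :=
  Nat.sInf_le h

/-- Existence ensures that the infimum is attained and is not the default `0` of an empty set. -/
theorem hasComplexEmbedding_NC {s : ℕ} (hs : 2 ≤ s) {m : ℕ} (hm : 1 ≤ m) :
    HasComplexEmbedding m (2 * s) (NC m (2 * s)) :=
  Nat.sInf_mem (exists_hasComplexEmbedding hs hm)

theorem NC_succ_le_of_odd {s : ℕ} (hs : 2 ≤ s) (hodd : Odd s) {m : ℕ} (hm : 1 ≤ m) :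
    (NC (m + 1) (2 * s) : ℝ) ≤ ((s : ℝ) + 1) ^ 2 / 2 * (NC m (2 * s) : ℝ) := by
  obtain ⟨a, rfl⟩ := Nat.exists_eq_add_of_le' hm
  have h := hasComplexEmbedding_NC hs hm
  obtain ⟨r, rfl⟩ := hodd
  have h1 : (NC (a + 1 + 1) (2 * (2 * r + 1)) : ℝ) ≤
      ((r + 1) * ((2 * r + 1 + 1) * NC (a + 1) (2 * (2 * r + 1))) : ℕ) := by
    exact_mod_cast h.succ_of_odd.NC_le
  refine h1.trans_eq ?_
  push_cast
  ring

theorem NC_succ_le_of_even {s : ℕ} (hs : 2 ≤ s) (heven : Even s) {m : ℕ} (hm : 1 ≤ m) :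
    (NC (m + 1) (2 * s) : ℝ) ≤ ((s : ℝ) + 2) / 2 * ((s : ℝ) * (NC m (2 * s) : ℝ) + 1) := by
  obtain ⟨a, rfl⟩ := Nat.exists_eq_add_of_le' hm
  have h := hasComplexEmbedding_NC hs hm
  obtain ⟨r, rfl⟩ := even_iff_exists_two_mul.1 heven
  have h1 : (NC (a + 1 + 1) (2 * (2 * r)) : ℝ) ≤
      (r * ((2 * r + 1) * NC (a + 1) (2 * (2 * r))) + 1 : ℕ) := by
    exact_mod_cast (h.succ_of_even (by omega)).NC_le
  refine h1.trans ?_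
  push_cast
  -- The Radau count beats the claimed bound by `r * NC (a + 1) (2 * (2 * r)) + r`.
  have h2 : (0 : ℝ) ≤ r * NC (a + 1) (2 * (2 * r)) := by positivity
  have h3 : (0 : ℝ) ≤ r := by positivity
  nlinarith

end Embedding

theorem corollary4p2 (s : ℕ) (hs : 2 ≤ s) :
    -- the minima exist
    (∀ m : ℕ, 1 ≤ m → ∃ n : ℕ, HasComplexEmbedding m (2 * s) n) ∧
    -- the recursive inequality
    (∀ m : ℕ, 2 ≤ m →
      (Odd s → (NC m (2 * s) : ℝ) ≤ ((s : ℝ) + 1) ^ 2 / 2 * (NC (m - 1) (2 * s) : ℝ)) ∧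
      (Even s → (NC m (2 * s) : ℝ) ≤
        ((s : ℝ) + 2) / 2 * ((s : ℝ) * (NC (m - 1) (2 * s) : ℝ) + 1))) ∧
    -- the explicit bounds for `m = 2`
    (Odd s → (NC 2 (2 * s) : ℝ) ≤ ((s : ℝ) + 1) ^ 2 / 2) ∧
    (Even s → (NC 2 (2 * s) : ℝ) ≤ ((s : ℝ) + 2) * ((s : ℝ) + 1) / 2) ∧
    -- the explicit bounds for `m = 3`
    (Odd s → (NC 3 (2 * s) : ℝ) ≤ ((s : ℝ) + 1) ^ 4 / 4) ∧
    (Even s → (NC 3 (2 * s) : ℝ) ≤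
      ((s : ℝ) + 2) / 2 * (((s : ℝ) + 2) * ((s : ℝ) + 1) * (s : ℝ) / 2 + 1)) := by
  have h1 : (NC 1 (2 * s) : ℝ) ≤ 1 := by
    exact_mod_cast (hasComplexEmbedding_one (p := 2 * s) (by omega)).NC_le
  have hodd2 : Odd s → (NC 2 (2 * s) : ℝ) ≤ ((s : ℝ) + 1) ^ 2 / 2 := fun ho =>
    (NC_succ_le_of_odd hs ho le_rfl).trans (mul_le_of_le_one_right (by positivity) h1)
  have heven2 : Even s → (NC 2 (2 * s) : ℝ) ≤ ((s : ℝ) + 2) * ((s : ℝ) + 1) / 2 := fun he => by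
    calc (NC 2 (2 * s) : ℝ) ≤ ((s : ℝ) + 2) / 2 * ((s : ℝ) * (NC 1 (2 * s) : ℝ) + 1) :=
          NC_succ_le_of_even hs he le_rfl
      _ ≤ ((s : ℝ) + 2) / 2 * ((s : ℝ) * 1 + 1) := by gcongr
      _ = _ := by ring
  refine ⟨fun m hm => exists_hasComplexEmbedding hs hm, fun m hm => ?_, hodd2, heven2,
    fun ho => ?_, fun he => ?_⟩
  · obtain ⟨m, rfl⟩ := Nat.exists_eq_add_of_le' (show 1 ≤ m by omega)
    exact ⟨fun ho => NC_succ_le_of_odd hs ho (by omega),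
      fun he => NC_succ_le_of_even hs he (by omega)⟩
  · calc (NC 3 (2 * s) : ℝ) ≤ ((s : ℝ) + 1) ^ 2 / 2 * (NC 2 (2 * s) : ℝ) :=
          NC_succ_le_of_odd hs ho one_le_two
      _ ≤ ((s : ℝ) + 1) ^ 2 / 2 * (((s : ℝ) + 1) ^ 2 / 2) := by
          have := hodd2 ho
          gcongr
      _ = _ := by ring
  · calc (NC 3 (2 * s) : ℝ) ≤ ((s : ℝ) + 2) / 2 * ((s : ℝ) * (NC 2 (2 * s) : ℝ) + 1) :=
          NC_succ_le_of_even hs he one_le_two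
      _ ≤ ((s : ℝ) + 2) / 2 * ((s : ℝ) * (((s : ℝ) + 2) * ((s : ℝ) + 1) / 2) + 1) := by
          have := heven2 he
          gcongr
      _ = _ := by ring
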